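/- Let $\Omega\subset\mathbb R^2$ be a bounded, strictly convex open domain containing the origin (the center), whose boundary is a closed real-analytic curve, and let $\gamma:\mathbb S^1=\mathbb R/L\mathbb Z\to\partial\Omega$ be an (analytic, bijective) unit speed parametrization of $\partial\Omega$, where $L$ is the length of $\partial\Omega$. Define $$\Psi:\mathbb S^1\times\mathbb S^1\to\mathbb R,\qquad \Psi(\xi,\eta)=|\gamma(\xi)|+|\gamma(\eta)|+|\gamma(\eta)-\gamma(\xi)|,$$ and $\varphi:\mathbb S^1\to\mathbb R$, $\varphi(\xi)=\Psi(\xi,\xi')$, where $\xi'=\xi'(\xi)$ is the parameter such that the segment from $0$ to $\gamma(\xi)$ is elastically reflected at $\gamma(\xi)$ into the segment from $\gamma(\xi)$ to $\gamma(\xi')$. A critical point of $\Psi$ is a point where $\Psi$ is differentiable with $\nabla\Psi=0$; the index of an isolated critical point is the index of the vector field $\nabla\Psi$ there, i.e. the winding number of $\nabla\Psi$ along small positively oriented circles around the point. Two distinct critical points $(\xi,\eta)$ and $(\xi',\eta')$ are called geometrically distinct if $(\xi,\eta)\neq(\eta',\xi')$. Then exactly one of the following holds: (i) the map $\varphi$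 is constant (that is, the center is a focal point of $\Omega$); (ii) there exist two isolated, geometrically distinct critical points of $\Psi$, one of which is a (global) maximum point of $\Psi$ with index $+1$ and the other of which has negative index. -/

import Mathlib

open Set Filter Topology

noncomputable section

/-- The Euclidean plane. -/
abbrev Plane : Type := EuclideanSpace ℝ (Fin 2)

/-- `γ : ℝ / Lℤ → ℝ²` is a real-analytic unit speed parametrization of the boundary of `Ω`:
a bijection of `ℝ / Lℤ` onto `∂Ω` whose periodic lift to `ℝ` is real-analytic with velocity
of norm one (hence `∂Ω` is a closed real-analytic curve of length `L`). -/
structure IsAnalyticUnitSpeedParam (Ω : Set Plane) {L : ℝ} (γ : AddCircle L → Plane) : Prop where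
  analytic : AnalyticOnNhd ℝ (fun t : ℝ => γ (t : AddCircle L)) univ
  unit_speed : ∀ t : ℝ, ‖deriv (fun s : ℝ => γ (s : AddCircle L)) t‖ = 1
  injective : Function.Injective γ
  range_eq : range γ = frontier Ω

/-- The velocity `γ'(ξ)`. -/
def velocity {L : ℝ} (γ : AddCircle L → Plane) (ξ : AddCircle L) : Plane :=
  deriv (fun t : ℝ => γ (ξ + (t : AddCircle L))) 0

/-- The perimeter function `Ψ(ξ, η) = |γ(ξ)| + |γ(η)| + |γ(η) - γ(ξ)|` of the triangle with
vertices `0`, `γ(ξ)`, `γ(η)`. -/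
def Psi {L : ℝ} (γ : AddCircle L → Plane) (p : AddCircle L × AddCircle L) : ℝ :=
  ‖γ p.1‖ + ‖γ p.2‖ + ‖γ p.2 - γ p.1‖

/-- The segment from `0` to `γ(ξ)` is elastically reflected at `γ(ξ)` into the segment from `γ(ξ)`
to `γ(ξ')`: the vector `γ(ξ') - γ(ξ)` is a positive multiple of the mirror image of the incoming
direction `γ(ξ) - 0` in the tangent line at `γ(ξ)`. -/
def ReflectsTo {L : ℝ} (γ : AddCircle L → Plane) (ξ ξ' : AddCircle L) : Prop :=
  ∃ t : ℝ, 0 < t ∧ γ ξ' - γ ξ = t • (Submodule.span ℝ {velocity γ ξ}).reflection (γ ξ)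

open Classical in
/-- The parameter `ξ' = ξ'(ξ)` of the point where the reflected ray hits the boundary again. (When
`γ` parametrizes the smooth boundary of a bounded strictly convex domain containing `0`, there is
exactly one such parameter; the default value `ξ` is never used.) -/
def nextParam {L : ℝ} (γ : AddCircle L → Plane) (ξ : AddCircle L) : AddCircle L :=
  if h : ∃ ξ', ReflectsTo γ ξ ξ' then h.choose else ξ

/-- `φ(ξ) = Ψ(ξ, ξ')`, the length of the closed broken line `0, γ(ξ), γ(ξ'), 0`, where the segment
from `0` to `γ(ξ)` is elastically reflected into the segment from `γ(ξ)` to `γ(ξ')`. -/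
def phi {L : ℝ} (γ : AddCircle L → Plane) (ξ : AddCircle L) : ℝ :=
  Psi γ (ξ, nextParam γ ξ)

/-- A function `f` on the torus, read in the chart `z ↦ p + (Re z, Im z)` centred at `p`. -/
def inChart {L : ℝ} (f : AddCircle L × AddCircle L → ℝ) (p : AddCircle L × AddCircle L)
    (z : ℂ) : ℝ :=
  f (p.1 + ((z.re : ℝ) : AddCircle L), p.2 + ((z.im : ℝ) : AddCircle L))

/-- `p` is a critical point of `f`: `f` is differentiable at `p` with zero gradient. (The
perimeter function is not differentiable on the diagonal, so that its critical points all lie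
off the diagonal.) -/
def IsCriticalPt {L : ℝ} (f : AddCircle L × AddCircle L → ℝ)
    (p : AddCircle L × AddCircle L) : Prop :=
  HasGradientAt (inChart f p) 0 0

/-- `p` is an isolated critical point of `f`. -/
def IsIsolatedCriticalPt {L : ℝ} (f : AddCircle L × AddCircle L → ℝ)
    (p : AddCircle L × AddCircle L) : Prop :=
  IsCriticalPt f p ∧ ∀ᶠ q in 𝓝[≠] p, ¬ IsCriticalPt f q

/-- The planar vector field `V` has index `n` at the point `z₀`: on every sufficiently small circle
`z₀ + r e^{it}`, `0 ≤ t ≤ 2π`, it has no zeros and a continuous determination `θ` of its argument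
increases by `2πn`; that is, `V / |V|` has winding number `n` along the circle. -/
def HasVectorFieldIndex (V : ℂ → ℂ) (z₀ : ℂ) (n : ℤ) : Prop :=
  ∃ R : ℝ, 0 < R ∧ ∀ r ∈ Ioo 0 R, ∃ θ : ℝ → ℝ,
    ContinuousOn θ (Icc 0 (2 * Real.pi)) ∧
    (∀ t ∈ Icc 0 (2 * Real.pi), V (circleMap z₀ r t) ≠ 0 ∧
      V (circleMap z₀ r t) =
        (‖V (circleMap z₀ r t)‖ : ℂ) * Complex.exp ((θ t : ℂ) * Complex.I)) ∧
    θ (2 * Real.pi) - θ 0 = 2 * Real.pi * (n : ℝ)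

/-- The critical point `p` of `f` has index `n`: the gradient field `∇f` has index `n` at `p`. -/
def HasCriticalIndex {L : ℝ} (f : AddCircle L × AddCircle L → ℝ)
    (p : AddCircle L × AddCircle L) (n : ℤ) : Prop :=
  HasVectorFieldIndex (gradient (inChart f p)) 0 n

/-- Two distinct points `(ξ, η)`, `(ξ', η')` are geometrically distinct if `(ξ, η) ≠ (η', ξ')`. -/
def GeometricallyDistinct {L : ℝ} (p q : AddCircle L × AddCircle L) : Prop :=
  p ≠ q ∧ p ≠ (q.2, q.1)

end

/-!
For an oval `c` around the origin the perimeter `Ψ(x, y)` of the triangle `0, c x, c y` has a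
derivative `∂₁Ψ(x, y)` that is strictly increasing in `y ∈ (x, x + L)`. Its only zero `g(x)` is the
parameter hit by the ray reflected at `c x`, and `g` is analytic with `g(x + L) = g(x) + L`. Hence
the critical points of `Ψ` are the points `(x, g(x))` at which the closing defect
`δ(x) = ∂₂Ψ(x, g(x))` vanishes, while `φ(x) = Ψ(x, g(x))` has derivative `δ · g'`. Since `g'` is
analytic and not identically zero, `φ` is constant exactly when `δ` is identically zero.

Otherwise the zeros of the analytic function `δ` are isolated. At a maximum of `Ψ` the defect
crosses zero downwards, so by periodicity it crosses zero upwards somewhere else. On a small circle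
around `(x, g(x))` the field `∇Ψ` has `∂₁Ψ = 0` only on the graph of `g`, where `∂₂Ψ` equals `δ`;
so the index is `1` at a downward and `-1` at an upward crossing.
-/

open scoped ContDiff RealInnerProductSpace EuclideanSpace

section OneVariable

theorem eventually_ne_of_contDiff_omega {f : ℝ → ℝ} (hf : ContDiff ℝ ω f) {a b : ℝ}
    (ha : f a ≠ b) (x : ℝ) : ∀ᶠ s in 𝓝[≠] x, f s ≠ b := by
  have han : AnalyticOnNhd ℝ f univ := contDiff_omega_iff_analyticOnNhd.1 hf
  by_contra h
  have heq : f =ᶠ[𝓝 x] fun _ => b :=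
    ((han x (mem_univ x)).frequently_eq_iff_eventually_eq analyticAt_const).1
      ((not_eventually.1 h).mono fun _ => not_not.1)
  exact ha (congrFun (han.eq_of_eventuallyEq analyticOnNhd_const heq) a)

theorem mul_pos_of_continuous_of_ne_zero {X : Type*} [TopologicalSpace X] [PreconnectedSpace X]
    {f : X → ℝ} (hf : Continuous f) (h0 : ∀ x, f x ≠ 0) (x y : X) : 0 < f x * f y := by
  by_contra! h
  obtain ⟨z, hz⟩ : (0 : ℝ) ∈ range f := by
    rcases mul_nonpos_iff.1 h with ⟨hx, hy⟩ | ⟨hx, hy⟩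
    · exact mem_range_of_exists_le_of_exists_ge hf ⟨y, hy⟩ ⟨x, hx⟩
    · exact mem_range_of_exists_le_of_exists_ge hf ⟨x, hx⟩ ⟨y, hy⟩
  exact h0 z hz

/-- `f` changes sign from negative to positive at `z`; a change from positive to negative is
expressed as `CrossesUp (-f) z`. -/
def CrossesUp (f : ℝ → ℝ) (z : ℝ) : Prop :=
  (∀ᶠ s in 𝓝[<] z, f s < 0) ∧ ∀ᶠ s in 𝓝[>] z, 0 < f s

namespace CrossesUp

variable {f : ℝ → ℝ} {z : ℝ}

theorem eq_zero (h : CrossesUp f z) (hf : ContinuousAt f z) : f z = 0 :=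
  le_antisymm (le_of_tendsto (hf.mono_left nhdsWithin_le_nhds) (h.1.mono fun _ hs => hs.le))
    (ge_of_tendsto (hf.mono_left nhdsWithin_le_nhds) (h.2.mono fun _ hs => hs.le))

theorem not_neg (h : CrossesUp f z) : ¬ CrossesUp (-f) z := fun h' => by
  obtain ⟨s, hs, hs'⟩ := (h.2.and h'.2).exists
  exact (neg_pos.1 hs').not_gt hs

theorem congr_sign {g : ℝ → ℝ} (h : CrossesUp f z) (hfg : ∀ᶠ s in 𝓝[≠] z, 0 < f s * g s) :
    CrossesUp g z := by
  rw [← nhdsLT_sup_nhdsGT, eventually_sup] at hfg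
  exact ⟨hfg.1.mp (h.1.mono fun s hs hp => neg_of_mul_pos_right hp hs.le),
    hfg.2.mp (h.2.mono fun s hs hp => pos_of_mul_pos_right hp hs.le)⟩

theorem comp_const_add (h : CrossesUp f z) : CrossesUp (fun s => f (z + s)) 0 := by
  have hl : map (z + ·) (𝓝[<] 0) = 𝓝[<] z := by simp
  have hr : map (z + ·) (𝓝[>] 0) = 𝓝[>] z := by simp
  rwa [CrossesUp, ← hl, ← hr, eventually_map, eventually_map] at h

end CrossesUp

theorem deriv_pos_or_neg_of_forall_ne_zero {f f' : ℝ → ℝ} {a b : ℝ}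
    (hf : ∀ s ∈ Icc a b, HasDerivAt f (f' s) s) (h0 : ∀ s ∈ Ioo a b, f' s ≠ 0) :
    ((∀ s ∈ Ioo a b, 0 < f' s) ∧ StrictMonoOn f (Icc a b)) ∨
      ((∀ s ∈ Ioo a b, f' s < 0) ∧ StrictAntiOn f (Icc a b)) := by
  have hcont : ContinuousOn f (Icc a b) := fun s hs => (hf s hs).continuousAt.continuousWithinAt
  have hderiv : ∀ s ∈ Ioo a b, deriv f s = f' s := fun s hs =>
    (hf s (Ioo_subset_Icc_self hs)).deriv
  rcases hasDerivWithinAt_forall_lt_or_forall_gt_of_forall_ne (convex_Ioo a b)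
    (fun s hs => (hf s (Ioo_subset_Icc_self hs)).hasDerivWithinAt) h0 with hneg | hpos
  · refine .inr ⟨hneg, strictAntiOn_of_deriv_neg (convex_Icc a b) hcont fun s hs => ?_⟩
    rw [interior_Icc] at hs
    exact (hderiv s hs).trans_lt (hneg s hs)
  · refine .inl ⟨hpos, strictMonoOn_of_deriv_pos (convex_Icc a b) hcont fun s hs => ?_⟩
    rw [interior_Icc] at hs
    exact (hpos s hs).trans_eq (hderiv s hs).symm

section Deriv

variable {f f' : ℝ → ℝ} {x : ℝ} (hf : ∀ᶠ s in 𝓝 x, HasDerivAt f (f' s) s)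
  (h0 : ∀ᶠ s in 𝓝[≠] x, f' s ≠ 0)

include hf h0

theorem eventually_deriv_pos_or_neg_nhdsGT :
    (∀ᶠ s in 𝓝[>] x, 0 < f' s ∧ f x < f s) ∨ ∀ᶠ s in 𝓝[>] x, f' s < 0 ∧ f s < f x := by
  obtain ⟨u, hu, hsub⟩ := mem_nhdsGE_iff_exists_Icc_subset.1 (nhdsWithin_le_nhds hf)
  obtain ⟨v, hv, hsub'⟩ := mem_nhdsGT_iff_exists_Ioo_subset.1 (nhdsGT_le_nhdsNE x h0)
  have hx : x ∈ Icc x (min u v) := left_mem_Icc.2 (le_min hu.le hv.le)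
  refine (deriv_pos_or_neg_of_forall_ne_zero (a := x) (b := min u v)
    (fun s hs => hsub ⟨hs.1, hs.2.trans (min_le_left u v)⟩)
    (fun s hs => hsub' ⟨hs.1, hs.2.trans_le (min_le_right u v)⟩)).imp ?_ ?_ <;>
  · rintro ⟨hsign, hmono⟩
    filter_upwards [Ioo_mem_nhdsGT (lt_min hu hv)] with s hs
    exact ⟨hsign s hs, hmono hx (Ioo_subset_Icc_self hs) hs.1⟩

theorem eventually_deriv_pos_or_neg_nhdsLT :
    (∀ᶠ s in 𝓝[<] x, 0 < f' s ∧ f s < f x) ∨ ∀ᶠ s in 𝓝[<] x, f' s < 0 ∧ f x < f s := by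
  obtain ⟨u, hu, hsub⟩ := mem_nhdsLE_iff_exists_Icc_subset.1 (nhdsWithin_le_nhds hf)
  obtain ⟨v, hv, hsub'⟩ := mem_nhdsLT_iff_exists_Ioo_subset.1 (nhdsLT_le_nhdsNE x h0)
  have hx : x ∈ Icc (max u v) x := right_mem_Icc.2 (max_le hu.le hv.le)
  refine (deriv_pos_or_neg_of_forall_ne_zero (a := max u v) (b := x)
    (fun s hs => hsub ⟨(le_max_left u v).trans hs.1, hs.2⟩)
    (fun s hs => hsub' ⟨(le_max_right u v).trans_lt hs.1, hs.2⟩)).imp ?_ ?_ <;>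
  · rintro ⟨hsign, hmono⟩
    filter_upwards [Ioo_mem_nhdsLT (max_lt hu hv)] with s hs
    exact ⟨hsign s hs, hmono (Ioo_subset_Icc_self hs) hx hs.2⟩

theorem crossesUp_neg_deriv_of_isLocalMax (hmax : IsLocalMax f x) : CrossesUp (-f') x := by
  constructor
  · rcases eventually_deriv_pos_or_neg_nhdsLT hf h0 with h | h
    · exact h.mono fun s hs => neg_neg_of_pos hs.1
    · obtain ⟨s, hs, hle⟩ := (h.and (nhdsWithin_le_nhds hmax)).exists
      exact absurd hle hs.2.not_ge
  · rcases eventually_deriv_pos_or_neg_nhdsGT hf h0 with h | h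
    · obtain ⟨s, hs, hle⟩ := (h.and (nhdsWithin_le_nhds hmax)).exists
      exact absurd hle hs.2.not_ge
    · exact h.mono fun s hs => neg_pos_of_neg hs.1

theorem crossesUp_deriv_of_isLocalMin (hmin : IsLocalMin f x) : CrossesUp f' x := by
  have := crossesUp_neg_deriv_of_isLocalMax (f := -f) (f' := -f')
    (hf.mono fun s hs => hs.neg) (h0.mono fun s => neg_ne_zero.2) hmin.neg
  rwa [neg_neg] at this

theorem eventually_deriv_pos_of_crossesUp (h : CrossesUp (fun s => f s - f x) x) :
    ∀ᶠ s in 𝓝[≠] x, 0 < f' s := by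
  rw [← nhdsLT_sup_nhdsGT, eventually_sup]
  constructor
  · rcases eventually_deriv_pos_or_neg_nhdsLT hf h0 with hd | hd
    · exact hd.mono fun s hs => hs.1
    · obtain ⟨s, hs, hlt⟩ := (hd.and h.1).exists
      exact absurd (sub_neg.1 hlt) hs.2.not_gt
  · rcases eventually_deriv_pos_or_neg_nhdsGT hf h0 with hd | hd
    · exact hd.mono fun s hs => hs.1
    · obtain ⟨s, hs, hlt⟩ := (hd.and h.2).exists
      exact absurd (sub_pos.1 hlt) hs.2.not_gt

end Deriv

theorem exists_crossesUp {f : ℝ → ℝ} (hf : Continuous f) (h0 : ∀ x, ∀ᶠ s in 𝓝[≠] x, f s ≠ 0)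
    {a b : ℝ} (hab : a < b) (ha : f a < 0) (hb : 0 < f b) : ∃ z, CrossesUp f z := by
  have hF : ∀ s, HasDerivAt (fun u => ∫ t in a..u, f t) (f s) s := fun s =>
    hf.integral_hasStrictDerivAt a s |>.hasDerivAt
  set F : ℝ → ℝ := fun u => ∫ t in a..u, f t
  obtain ⟨z, hz, hmin⟩ := isCompact_Icc.exists_isMinOn (nonempty_Icc.2 hab.le)
    (fun s _ => (hF s).continuousAt.continuousWithinAt)
  have hvar : ∀ w ∈ Icc a b, 0 ≤ (w - z) * f z := fun w hw => by
    have hseg : segment ℝ z w ⊆ Icc a b := (convex_Icc a b).segment_subset hz hw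
    simpa using hmin.localize.hasFDerivWithinAt_nonneg (hF z).hasDerivWithinAt.hasFDerivWithinAt
      (sub_mem_posTangentConeAt_of_segment_subset hseg)
  have hza : z ≠ a := by
    rintro rfl
    exact (mul_neg_of_pos_of_neg (sub_pos.2 hab) ha).not_ge (hvar b (right_mem_Icc.2 hab.le))
  have hzb : z ≠ b := by
    rintro rfl
    exact (mul_neg_of_neg_of_pos (sub_neg.2 hab) hb).not_ge (hvar a (left_mem_Icc.2 hab.le))
  exact ⟨z, crossesUp_deriv_of_isLocalMin (.of_forall hF) (h0 z)
    (hmin.isLocalMin (Icc_mem_nhds (hz.1.lt_of_ne' hza) (hz.2.lt_of_ne hzb)))⟩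

theorem contDiffAt_of_eventually_unique_zero {F : ℝ × ℝ → ℝ} {g : ℝ → ℝ} {x F₂ : ℝ} {n : ℕ∞ω}
    (hF : ContDiffAt ℝ n F (x, g x)) (hn : n ≠ 0) (hF₂ : HasDerivAt (fun y => F (x, y)) F₂ (g x))
    (hF₂0 : F₂ ≠ 0) (hx : F (x, g x) = 0) (hg : ∀ᶠ p in 𝓝 (x, g x), F p = 0 → p.2 = g p.1) :
    ContDiffAt ℝ n g x := by
  have hpartial : fderiv ℝ F (x, g x) (0, 1) = F₂ :=
    ((hF.differentiableAt hn).hasFDerivAt.comp_hasDerivAt (f := fun y => (x, y)) (g x)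
      ((hasDerivAt_const _ x).prodMk (hasDerivAt_id _))).unique hF₂
  have hinv : (fderiv ℝ F (x, g x) ∘L .inr ℝ ℝ ℝ).IsInvertible :=
    ⟨ContinuousLinearEquiv.unitsEquivAut ℝ (Units.mk0 F₂ hF₂0), by ext; simp [hpartial]⟩
  have hψ := hF.contDiffAt_implicitFunction hn hinv
  have hself := hF.implicitFunction_apply_self hn hinv
  refine hψ.congr_of_eventuallyEq ?_
  have hlim : Tendsto (fun s => (s, hF.implicitFunction hn hinv s)) (𝓝 x) (𝓝 (x, g x)) := by
    have := (continuousAt_id (x := x)).prodMk hψ.continuousAt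
    rwa [ContinuousAt, hself] at this
  filter_upwards [hF.eventually_apply_implicitFunction hn hinv, hlim.eventually hg] with s hs hgs
  exact (hgs (hs.trans hx)).symm

end OneVariable

theorem exists_strict_supporting_functional {E : Type*} [NormedAddCommGroup E] [NormedSpace ℝ E]
    {s : Set E} (hopen : IsOpen s) (hconv : Convex ℝ s) (hstrict : StrictConvex ℝ (closure s))
    {a : E} (ha : a ∈ frontier s) :
    ∃ f : E →L[ℝ] ℝ, (∀ b ∈ s, f b < f a) ∧ ∀ b ∈ frontier s, b ≠ a → f b < f a := by
  have hne : s.Nonempty := closure_nonempty_iff.1 ⟨a, frontier_subset_closure ha⟩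
  have has : a ∉ s := (hopen.frontier_eq ▸ ha).2
  obtain ⟨f, hf⟩ := geometric_hahn_banach_open_point hconv hopen has
  refine ⟨f, hf, fun b hb hba => ?_⟩
  have hmid : (1 / 2 : ℝ) • b + (1 / 2 : ℝ) • a ∈ s := by
    have := hstrict (frontier_subset_closure hb) (frontier_subset_closure ha) hba
      one_half_pos one_half_pos (add_halves 1)
    rwa [hconv.interior_closure_eq_interior_of_nonempty_interior (by rwa [hopen.interior_eq]),
      hopen.interior_eq] at this
  have := hf _ hmid
  rw [map_add, map_smul, map_smul, smul_eq_mul, smul_eq_mul] at this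
  linarith

section OrientedPlane

open Module NormedSpace

variable {E : Type*} [NormedAddCommGroup E] [InnerProductSpace ℝ E] [Fact (finrank ℝ E = 2)]
  (o : Orientation ℝ E (Fin 2))

theorem areaForm_mul_areaForm_neg {f : E →L[ℝ] ℝ} {v a b : E} (hv : v ≠ 0) (hfv : f v = 0)
    (hab : f a * f b < 0) : o.areaForm v a * o.areaForm v b < 0 := by
  have : FiniteDimensional ℝ E := .of_fact_finrank_eq_two
  obtain ⟨w, rfl⟩ := (InnerProductSpace.toDual ℝ E).surjective f
  simp only [InnerProductSpace.toDual_apply_apply] at hfv hab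
  have hw : ∀ u, o.areaForm v w * o.areaForm v u = ‖v‖ ^ 2 * ⟪w, u⟫ := fun u => by
    simpa [real_inner_comm w v, hfv] using o.inner_mul_inner_add_areaForm_mul_areaForm v w u
  have hprod : o.areaForm v w ^ 2 * (o.areaForm v a * o.areaForm v b) =
      ‖v‖ ^ 4 * (⟪w, a⟫ * ⟪w, b⟫) := by
    rw [sq, mul_mul_mul_comm, hw, hw]; ring
  refine neg_of_mul_neg_right (hprod.trans_lt ?_) (sq_nonneg _)
  exact mul_neg_of_pos_of_neg (pow_pos (norm_pos_iff.2 hv) 4) hab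

theorem eq_of_inner_eq_of_areaForm_eq {v a b : E} (hv : v ≠ 0) (hin : ⟪v, a⟫ = ⟪v, b⟫)
    (har : o.areaForm v a = o.areaForm v b) : a = b := by
  have h := o.inner_sq_add_areaForm_sq v (a - b)
  rw [inner_sub_right, map_sub, hin, har] at h
  simpa [hv, sub_eq_zero, eq_comm] using h

theorem inner_reflection_span_singleton {E : Type*} [NormedAddCommGroup E]
    [InnerProductSpace ℝ E] (v b : E) :
    ⟪v, (Submodule.span ℝ {v}).reflection b⟫ = ⟪v, b⟫ := by
  have hv := Submodule.reflection_mem_subspace_eq_self (𝕜 := ℝ)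
    (Submodule.mem_span_singleton_self v)
  rw [← LinearIsometryEquiv.inner_map_map (Submodule.span ℝ {v}).reflection v b, hv]

theorem areaForm_reflection_span_singleton (v b : E) :
    o.areaForm v ((Submodule.span ℝ {v}).reflection b) = -o.areaForm v b := by
  simp [Submodule.reflection_singleton_apply]

theorem eq_reflection_of_inner_eq {v a b : E} (hnorm : ‖a‖ = ‖b‖) (hin : ⟪v, a⟫ = ⟪v, b⟫)
    (hside : o.areaForm v a * o.areaForm v b < 0) :
    a = (Submodule.span ℝ {v}).reflection b := by
  have hv : v ≠ 0 := by
    rintro rfl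
    simp at hside
  have hsq : o.areaForm v a ^ 2 = o.areaForm v b ^ 2 := by
    have ha := o.inner_sq_add_areaForm_sq v a
    rwa [hnorm, hin, ← o.inner_sq_add_areaForm_sq v b, add_right_inj] at ha
  refine eq_of_inner_eq_of_areaForm_eq o hv (by rw [hin, inner_reflection_span_singleton]) ?_
  rw [areaForm_reflection_span_singleton]
  refine (sq_eq_sq_iff_eq_or_eq_neg.1 hsq).resolve_left fun heq => ?_
  exact (heq ▸ hside).not_ge (mul_self_nonneg _)

theorem exists_eq_smul_reflection_iff {v a b : E}
    (hside : o.areaForm v a * o.areaForm v b < 0) :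
    (∃ t : ℝ, 0 < t ∧ a = t • (Submodule.span ℝ {v}).reflection b) ↔
      ⟪v, normalize a⟫ = ⟪v, normalize b⟫ := by
  have ha : 0 < ‖a‖ := norm_pos_iff.2 (by rintro rfl; simp at hside)
  have hb : 0 < ‖b‖ := norm_pos_iff.2 (by rintro rfl; simp at hside)
  constructor
  · rintro ⟨t, ht, rfl⟩
    rw [normalize_smul_of_pos ht, NormedSpace.normalize, LinearIsometryEquiv.norm_map,
      inner_smul_right, inner_reflection_span_singleton, ← inner_smul_right, NormedSpace.normalize]
  · intro hin
    have hside' : o.areaForm v (normalize a) * o.areaForm v (normalize b) < 0 := by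
      simp only [NormedSpace.normalize, map_smul, smul_eq_mul]
      rw [mul_mul_mul_comm]
      exact mul_neg_of_pos_of_neg (by positivity) hside
    have hrefl := eq_reflection_of_inner_eq o
      (by rw [norm_normalize (norm_pos_iff.1 ha), norm_normalize (norm_pos_iff.1 hb)]) hin hside'
    refine ⟨‖a‖ / ‖b‖, by positivity, ?_⟩
    calc a = ‖a‖ • (Submodule.span ℝ {v}).reflection (normalize b) := by
          rw [← hrefl, norm_smul_normalize]
      _ = (‖a‖ / ‖b‖) • (Submodule.span ℝ {v}).reflection b := by
          rw [NormedSpace.normalize, map_smul, smul_smul, div_eq_mul_inv]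

end OrientedPlane

section Perimeter

/-- The perimeter of the triangle with vertices `0`, `c x`, `c y`. -/
noncomputable def perimeter {X E : Type*} [NormedAddCommGroup E] (c : X → E) (x y : X) : ℝ :=
  ‖c x‖ + ‖c y‖ + ‖c y - c x‖

theorem perimeter_comm {X E : Type*} [NormedAddCommGroup E] (c : X → E) (x y : X) :
    perimeter c x y = perimeter c y x := by
  rw [perimeter, perimeter, norm_sub_rev, add_comm ‖c x‖]

open NormedSpace

variable {E : Type*} [NormedAddCommGroup E] [InnerProductSpace ℝ E]

theorem hasFDerivAt_norm {v : E} (hv : v ≠ 0) :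
    HasFDerivAt (fun w : E => ‖w‖) (innerSL ℝ (normalize v)) v := by
  have h := (hasStrictFDerivAt_norm_sq v).hasFDerivAt.sqrt (by simpa using hv)
  simp only [Real.sqrt_sq (norm_nonneg _)] at h
  refine h.congr_fderiv ?_
  ext w
  simp only [one_div, mul_inv_rev, smul_apply, coe_innerSL_apply, nsmul_eq_mul, Nat.cast_ofNat,
    smul_eq_mul, NormedSpace.normalize, map_smul]
  field_simp

theorem hasDerivAt_inner_normalize [Fact (Module.finrank ℝ E = 2)]
    (o : Orientation ℝ E (Fin 2)) (v : E) {w : ℝ → E} {w' : E} {t : ℝ} (hw : HasDerivAt w w' t)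
    (h0 : w t ≠ 0) :
    HasDerivAt (fun s => ⟪v, normalize (w s)⟫)
      (o.areaForm (w t) v * o.areaForm (w t) w' / ‖w t‖ ^ 3) t := by
  have hn : ‖w t‖ ≠ 0 := norm_ne_zero_iff.2 h0
  have hnorm := (hasFDerivAt_norm h0).comp_hasDerivAt t hw
  refine ((hasDerivAt_const t v).inner ℝ ((hnorm.inv hn).smul hw)).congr_deriv ?_
  have := o.inner_mul_inner_add_areaForm_mul_areaForm (w t) v w'
  simp only [Pi.inv_apply, Function.comp_apply, NormedSpace.normalize, map_smul, smul_apply,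
    coe_innerSL_apply, smul_eq_mul, inner_add_right, inner_smul_right, Pi.smul_apply',
    inner_zero_left, mul_zero, add_zero]
  field_simp
  rw [real_inner_comm (w t) v]
  linear_combination -this

/-- The partial derivative of `perimeter c` in its first variable at `(x, y)`; by symmetry, the
partial derivative in the second variable is `perimeterDeriv c y x`. -/
noncomputable def perimeterDeriv (c : ℝ → E) (x y : ℝ) : ℝ :=
  ⟪deriv c x, normalize (c x)⟫ + ⟪deriv c x, normalize (c x - c y)⟫

variable {c : ℝ → E} {x y : ℝ}

theorem hasFDerivAt_perimeter (hx : DifferentiableAt ℝ c x) (hy : DifferentiableAt ℝ c y)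
    (hx0 : c x ≠ 0) (hy0 : c y ≠ 0) (hxy : c x ≠ c y) :
    HasFDerivAt (fun p : ℝ × ℝ => perimeter c p.1 p.2)
      (perimeterDeriv c x y • ContinuousLinearMap.fst ℝ ℝ ℝ +
        perimeterDeriv c y x • ContinuousLinearMap.snd ℝ ℝ ℝ) (x, y) := by
  have h1 : HasFDerivAt (fun p : ℝ × ℝ => c p.1) _ (x, y) :=
    hx.hasDerivAt.hasFDerivAt.comp (x, y) hasFDerivAt_fst
  have h2 : HasFDerivAt (fun p : ℝ × ℝ => c p.2) _ (x, y) :=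
    hy.hasDerivAt.hasFDerivAt.comp (x, y) hasFDerivAt_snd
  have h := (((hasFDerivAt_norm hx0).comp (x, y) h1).add
    ((hasFDerivAt_norm hy0).comp (x, y) h2)).add
    ((hasFDerivAt_norm (sub_ne_zero.2 hxy.symm)).comp (x, y) (h2.sub h1))
  have hneg : normalize (c y - c x) = -normalize (c x - c y) := by rw [← normalize_neg, neg_sub]
  refine h.congr_fderiv ?_
  ext <;> simp [perimeterDeriv, real_inner_comm, hneg]

theorem contDiffAt_perimeterDeriv {n : ℕ∞ω} (hc : ContDiffAt ℝ n c x)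
    (hc' : ContDiffAt ℝ n (deriv c) x) (hy : ContDiffAt ℝ n c y) (hx0 : c x ≠ 0) (hxy : c x ≠ c y) :
    ContDiffAt ℝ n (fun p : ℝ × ℝ => perimeterDeriv c p.1 p.2) (x, y) := by
  have hcx : ContDiffAt ℝ n (fun p : ℝ × ℝ => c p.1) (x, y) := hc.comp _ contDiffAt_fst
  have hcy : ContDiffAt ℝ n (fun p : ℝ × ℝ => c p.2) (x, y) := hy.comp _ contDiffAt_snd
  have hdx : ContDiffAt ℝ n (fun p : ℝ × ℝ => deriv c p.1) (x, y) := hc'.comp (x, y) contDiffAt_fst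
  have hsub : c x - c y ≠ 0 := sub_ne_zero.2 hxy
  exact (hdx.inner ℝ (((hcx.norm ℝ hx0).inv (norm_ne_zero_iff.2 hx0)).smul hcx)).add
    (hdx.inner ℝ ((((hcx.sub hcy).norm ℝ hsub).inv (norm_ne_zero_iff.2 hsub)).smul (hcx.sub hcy)))

theorem hasDerivAt_perimeterDeriv_right [Fact (Module.finrank ℝ E = 2)]
    (o : Orientation ℝ E (Fin 2)) (hy : DifferentiableAt ℝ c y) (hxy : c x ≠ c y) :
    HasDerivAt (perimeterDeriv c x) (o.areaForm (deriv c x) (c y - c x) *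
      o.areaForm (deriv c y) (c x - c y) / ‖c x - c y‖ ^ 3) y := by
  refine ((hasDerivAt_inner_normalize o (deriv c x) (hy.hasDerivAt.const_sub (c x))
    (sub_ne_zero.2 hxy)).const_add _).congr_deriv ?_
  rw [o.areaForm_swap, o.areaForm_swap _ (-deriv c y), ← map_neg, neg_sub, map_neg]
  simp

theorem not_differentiableAt_norm_sub {c' : E} (hc : HasDerivAt c c' x) (hc' : c' ≠ 0) :
    ¬ DifferentiableAt ℝ (fun s => ‖c s - c x‖) x := fun h => by
  have hmin : IsLocalMin (fun s => ‖c s - c x‖) x := .of_forall fun s => by simp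
  have h0 : HasDerivAt (fun s => ‖c s - c x‖) 0 x := by
    simpa only [hmin.deriv_eq_zero] using h.hasDerivAt
  have hzero : HasDerivAt c 0 x := by
    rw [hasDerivAt_iff_isLittleO] at h0 ⊢
    simpa using h0
  exact hc' (hc.unique hzero)

theorem not_differentiableAt_perimeter_diag (hx : DifferentiableAt ℝ c x) (hx0 : c x ≠ 0)
    (hx' : deriv c x ≠ 0) :
    ¬ DifferentiableAt ℝ (fun p : ℝ × ℝ => perimeter c p.1 p.2) (x, x) := fun h => by
  have hcomp : DifferentiableAt ℝ (fun s => perimeter c x s) x :=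
    h.comp x (f := fun s : ℝ => (x, s)) (by fun_prop)
  refine not_differentiableAt_norm_sub hx.hasDerivAt hx' ?_
  refine (hcomp.sub ((hx.norm ℝ hx0).const_add ‖c x‖)).congr_of_eventuallyEq
    (.of_forall fun s => ?_)
  simp [perimeter]

theorem tendsto_normalize_slope (hx : DifferentiableAt ℝ c x) (hx' : ‖deriv c x‖ = 1) :
    Tendsto (fun y => normalize (slope c x y)) (𝓝[≠] x) (𝓝 (deriv c x)) := by
  have h := hx.hasDerivAt.tendsto_slope
  simpa [NormedSpace.normalize, hx'] using (h.norm.inv₀ (by simp [hx'])).smul h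

theorem tendsto_perimeterDeriv_nhdsGT (hx : DifferentiableAt ℝ c x) (hx' : ‖deriv c x‖ = 1) :
    Tendsto (perimeterDeriv c x) (𝓝[>] x) (𝓝 (⟪deriv c x, normalize (c x)⟫ - 1)) := by
  have h := (tendsto_const_nhds (x := deriv c x)).inner (𝕜 := ℝ)
    ((tendsto_normalize_slope hx hx').mono_left (nhdsGT_le_nhdsNE x))
  rw [real_inner_self_eq_norm_sq, hx', one_pow] at h
  refine (h.const_sub _).congr' ?_
  filter_upwards [self_mem_nhdsWithin] with y (hy : x < y)
  rw [slope_def_module, normalize_smul_of_pos (inv_pos.2 (sub_pos.2 hy)), perimeterDeriv,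
    ← neg_sub (c y), normalize_neg, inner_neg_right, sub_eq_add_neg]

theorem tendsto_perimeterDeriv_nhdsLT (hx : DifferentiableAt ℝ c x) (hx' : ‖deriv c x‖ = 1) :
    Tendsto (perimeterDeriv c x) (𝓝[<] x) (𝓝 (⟪deriv c x, normalize (c x)⟫ + 1)) := by
  have h := (tendsto_const_nhds (x := deriv c x)).inner (𝕜 := ℝ)
    ((tendsto_normalize_slope hx hx').mono_left (nhdsLT_le_nhdsNE x))
  rw [real_inner_self_eq_norm_sq, hx', one_pow] at h
  refine (h.const_add _).congr' ?_
  filter_upwards [self_mem_nhdsWithin] with y (hy : y < x)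
  rw [slope_comm, slope_def_module, normalize_smul_of_pos (inv_pos.2 (sub_pos.2 hy)),
    perimeterDeriv]

end Perimeter

theorem eventually_mem_Ioo_add {L x y : ℝ} (hy : y ∈ Ioo x (x + L)) :
    ∀ᶠ p : ℝ × ℝ in 𝓝 (x, y), p.2 ∈ Ioo p.1 (p.1 + L) :=
  ((isOpen_lt continuous_fst continuous_snd).inter
    (isOpen_lt continuous_snd (continuous_fst.add_const L))).mem_nhds hy

open Module NormedSpace in
/-- `c` is a real-analytic unit speed closed curve of length `L` for which the origin and all other
points of the curve lie strictly on the same side of the tangent line at `c x`, that is, of the zero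
set of `p ↦ o.areaForm (deriv c x) (p - c x)`. -/
structure IsOval {E : Type*} [NormedAddCommGroup E] [InnerProductSpace ℝ E]
    [Fact (finrank ℝ E = 2)] (o : Orientation ℝ E (Fin 2)) (c : ℝ → E) (L : ℝ) : Prop where
  pos : 0 < L
  contDiff : ContDiff ℝ ω c
  norm_deriv : ∀ x, ‖deriv c x‖ = 1
  periodic : Function.Periodic c L
  side : ∀ x, ∀ y ∈ Ioo x (x + L),
    o.areaForm (deriv c x) (c y - c x) * o.areaForm (deriv c x) (c x) < 0

namespace IsOval

open Module NormedSpace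

variable {E : Type*} [NormedAddCommGroup E] [InnerProductSpace ℝ E] [Fact (finrank ℝ E = 2)]
  {o : Orientation ℝ E (Fin 2)} {c : ℝ → E} {L x y : ℝ}

theorem differentiable (h : IsOval o c L) : Differentiable ℝ c :=
  h.contDiff.differentiable (by simp)

theorem contDiff_deriv (h : IsOval o c L) : ContDiff ℝ ω (deriv c) := by
  have : FiniteDimensional ℝ E := .of_fact_finrank_eq_two
  have := FiniteDimensional.complete ℝ E
  exact (contDiff_omega_iff_analyticOnNhd.1 h.contDiff).deriv.contDiff

theorem areaForm_ne_zero (h : IsOval o c L) (x : ℝ) : o.areaForm (deriv c x) (c x) ≠ 0 :=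
  right_ne_zero_of_mul
    (h.side x (x + L / 2) ⟨by linarith [h.pos], by linarith [h.pos]⟩).ne

theorem ne_zero (h : IsOval o c L) (x : ℝ) : c x ≠ 0 := fun h0 =>
  h.areaForm_ne_zero x (by rw [h0, map_zero])

theorem ne (h : IsOval o c L) (hy : y ∈ Ioo x (x + L)) : c x ≠ c y := fun heq =>
  left_ne_zero_of_mul (h.side x y hy).ne (by rw [heq, sub_self, map_zero])

theorem periodic_deriv (h : IsOval o c L) : Function.Periodic (deriv c) L := fun x => by
  rw [← deriv_comp_add_const, funext h.periodic]

theorem add_period_mem (hy : y ∈ Ioo x (x + L)) : x + L ∈ Ioo y (y + L) :=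
  ⟨hy.2, add_lt_add_left hy.1 L⟩

theorem perimeterDeriv_add_period_left (h : IsOval o c L) (x y : ℝ) :
    perimeterDeriv c (x + L) y = perimeterDeriv c x y := by
  simp only [perimeterDeriv, h.periodic x, h.periodic_deriv x]

theorem perimeterDeriv_add_period_right (h : IsOval o c L) (x y : ℝ) :
    perimeterDeriv c x (y + L) = perimeterDeriv c x y := by
  simp only [perimeterDeriv, h.periodic y]

theorem areaForm_mul_areaForm_pos (h : IsOval o c L) (hy : y ∈ Ioo x (x + L)) :
    0 < o.areaForm (deriv c x) (c y - c x) * o.areaForm (deriv c y) (c x - c y) := by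
  have hxy := h.side x y hy
  have hyx := h.side y (x + L) (add_period_mem hy)
  rw [h.periodic x] at hyx
  have hcont : Continuous fun s => o.areaForm (deriv c s) (c s) :=
    (o.areaForm'.continuous.comp h.contDiff_deriv.continuous).clm_apply h.contDiff.continuous
  have hpos := mul_pos_of_continuous_of_ne_zero hcont h.areaForm_ne_zero x y
  refine pos_of_mul_pos_left ?_ hpos.le
  rw [mul_mul_mul_comm]
  exact mul_pos_of_neg_of_neg hxy hyx

theorem abs_inner_normalize_lt_one (h : IsOval o c L) (x : ℝ) :
    |⟪deriv c x, normalize (c x)⟫| < 1 := by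
  have hsq := o.inner_sq_add_areaForm_sq (deriv c x) (normalize (c x))
  rw [h.norm_deriv, norm_normalize (h.ne_zero x)] at hsq
  have harea : o.areaForm (deriv c x) (normalize (c x)) ≠ 0 := by
    rw [NormedSpace.normalize, map_smul, smul_eq_mul]
    exact mul_ne_zero (inv_ne_zero (norm_ne_zero_iff.2 (h.ne_zero x))) (h.areaForm_ne_zero x)
  rw [← sq_lt_one_iff_abs_lt_one]
  linarith [sq_pos_of_ne_zero harea]

theorem hasDerivAt_perimeterDeriv_right (h : IsOval o c L) (hy : y ∈ Ioo x (x + L)) :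
    ∃ d, 0 < d ∧ HasDerivAt (perimeterDeriv c x) d y :=
  ⟨_, div_pos (h.areaForm_mul_areaForm_pos hy)
    (pow_pos (norm_pos_iff.2 (sub_ne_zero.2 (h.ne hy))) 3),
    _root_.hasDerivAt_perimeterDeriv_right o (h.differentiable y) (h.ne hy)⟩

theorem continuousOn_perimeterDeriv (h : IsOval o c L) (x : ℝ) :
    ContinuousOn (perimeterDeriv c x) (Ioo x (x + L)) := fun _ hy =>
  let ⟨_, _, hd⟩ := h.hasDerivAt_perimeterDeriv_right hy
  hd.continuousAt.continuousWithinAt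

theorem strictMonoOn_perimeterDeriv (h : IsOval o c L) (x : ℝ) :
    StrictMonoOn (perimeterDeriv c x) (Ioo x (x + L)) := by
  refine strictMonoOn_of_deriv_pos (convex_Ioo _ _) (h.continuousOn_perimeterDeriv x)
    fun y hy => ?_
  obtain ⟨d, hd, hderiv⟩ := h.hasDerivAt_perimeterDeriv_right (interior_subset hy)
  rwa [hderiv.deriv]

theorem exists_perimeterDeriv_eq_zero (h : IsOval o c L) (x : ℝ) :
    ∃ y ∈ Ioo x (x + L), perimeterDeriv c x y = 0 := by
  have hx := h.differentiable x
  have hlt := abs_lt.1 (h.abs_inner_normalize_lt_one x)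
  have hleft : ∀ᶠ y in 𝓝[>] x, perimeterDeriv c x y < 0 :=
    (tendsto_perimeterDeriv_nhdsGT hx (h.norm_deriv x)).eventually_lt_const (by linarith)
  have hright : ∀ᶠ y in 𝓝[<] x, 0 < perimeterDeriv c x y :=
    (tendsto_perimeterDeriv_nhdsLT hx (h.norm_deriv x)).eventually_const_lt (by linarith)
  obtain ⟨a, ha, haI⟩ := (hleft.and (Ioo_mem_nhdsGT (lt_add_of_pos_right x h.pos))).exists
  obtain ⟨b, hb, hbI⟩ := (hright.and (Ioo_mem_nhdsLT (sub_lt_self x h.pos))).exists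
  rw [← h.perimeterDeriv_add_period_right x b] at hb
  exact isPreconnected_Ioo.intermediate_value haI
    ⟨by linarith [hbI.1], by linarith [hbI.2]⟩ (h.continuousOn_perimeterDeriv x)
    ⟨ha.le, hb.le⟩

/-- The parameter in `(x, x + L)` of the point at which the ray from the origin, reflected at `c x`,
hits the curve again. -/
noncomputable def bounce (h : IsOval o c L) (x : ℝ) : ℝ :=
  (h.exists_perimeterDeriv_eq_zero x).choose

section Bounce

variable (h : IsOval o c L)

include h

theorem bounce_mem (x : ℝ) : h.bounce x ∈ Ioo x (x + L) :=
  (h.exists_perimeterDeriv_eq_zero x).choose_spec.1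

theorem perimeterDeriv_bounce (x : ℝ) : perimeterDeriv c x (h.bounce x) = 0 :=
  (h.exists_perimeterDeriv_eq_zero x).choose_spec.2

theorem perimeterDeriv_eq_zero_iff (hy : y ∈ Ioo x (x + L)) :
    perimeterDeriv c x y = 0 ↔ y = h.bounce x := by
  rw [← h.perimeterDeriv_bounce x,
    (h.strictMonoOn_perimeterDeriv x).injOn.eq_iff hy (h.bounce_mem x)]

theorem perimeterDeriv_pos_iff (hy : y ∈ Ioo x (x + L)) :
    0 < perimeterDeriv c x y ↔ h.bounce x < y := by
  rw [← h.perimeterDeriv_bounce x,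
    (h.strictMonoOn_perimeterDeriv x).lt_iff_lt (h.bounce_mem x) hy]

theorem perimeterDeriv_neg_iff (hy : y ∈ Ioo x (x + L)) :
    perimeterDeriv c x y < 0 ↔ y < h.bounce x := by
  rw [← h.perimeterDeriv_bounce x,
    (h.strictMonoOn_perimeterDeriv x).lt_iff_lt hy (h.bounce_mem x)]

theorem bounce_add_period (x : ℝ) : h.bounce (x + L) = h.bounce x + L := by
  obtain ⟨hl, hr⟩ := h.bounce_mem x
  refine ((h.perimeterDeriv_eq_zero_iff ⟨by linarith, by linarith⟩).1 ?_).symm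
  rw [h.perimeterDeriv_add_period_left, h.perimeterDeriv_add_period_right, h.perimeterDeriv_bounce]

theorem contDiff_bounce : ContDiff ℝ ω h.bounce := by
  refine contDiff_iff_contDiffAt.2 fun x => ?_
  obtain ⟨d, hd, hderiv⟩ := h.hasDerivAt_perimeterDeriv_right (h.bounce_mem x)
  refine contDiffAt_of_eventually_unique_zero (F := fun p => perimeterDeriv c p.1 p.2)
    (_root_.contDiffAt_perimeterDeriv h.contDiff.contDiffAt h.contDiff_deriv.contDiffAt
      h.contDiff.contDiffAt (h.ne_zero x) (h.ne (h.bounce_mem x)))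
    (by simp) hderiv hd.ne' (h.perimeterDeriv_bounce x) ?_
  filter_upwards [eventually_mem_Ioo_add (h.bounce_mem x)] with p hp
  exact (h.perimeterDeriv_eq_zero_iff hp).1

theorem hasDerivAt_bounce (x : ℝ) : HasDerivAt h.bounce (deriv h.bounce x) x :=
  (h.contDiff_bounce.differentiable (by simp) x).hasDerivAt

theorem exists_bounce_ne (b : ℝ) : ∃ x, h.bounce x ≠ b := by
  by_contra! hconst
  linarith [h.bounce_add_period 0, hconst 0, hconst (0 + L), h.pos]

theorem eventually_bounce_ne (x b : ℝ) : ∀ᶠ s in 𝓝[≠] x, h.bounce s ≠ b :=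
  let ⟨_, ha⟩ := h.exists_bounce_ne b
  eventually_ne_of_contDiff_omega h.contDiff_bounce ha x

theorem eventually_deriv_bounce_ne_zero (x : ℝ) : ∀ᶠ s in 𝓝[≠] x, deriv h.bounce s ≠ 0 := by
  obtain ⟨a, ha⟩ : ∃ a, deriv h.bounce a ≠ 0 := by
    by_contra! hconst
    obtain ⟨a, ha⟩ := h.exists_bounce_ne (h.bounce 0)
    exact ha (is_const_of_deriv_eq_zero (h.contDiff_bounce.differentiable (by simp)) hconst a 0)
  exact eventually_ne_of_contDiff_omega
    (contDiff_omega_iff_analyticOnNhd.1 h.contDiff_bounce).deriv.contDiff ha x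

end Bounce

/-- The partial derivative of the perimeter in its second variable at the reflected chord from `c x`
to `c (h.bounce x)`; it vanishes when the chord is also reflected back to the origin. -/
noncomputable def closingDefect (h : IsOval o c L) (x : ℝ) : ℝ :=
  perimeterDeriv c (h.bounce x) x

section ClosingDefect

variable (h : IsOval o c L)

include h

theorem contDiff_closingDefect : ContDiff ℝ ω h.closingDefect := by
  refine contDiff_iff_contDiffAt.2 fun x => ?_
  have hF : ContDiffAt ℝ ω (fun p : ℝ × ℝ => perimeterDeriv c p.1 p.2) (h.bounce x, x) :=
    contDiffAt_perimeterDeriv h.contDiff.contDiffAt h.contDiff_deriv.contDiffAt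
      h.contDiff.contDiffAt (h.ne_zero _) (h.ne (h.bounce_mem x)).symm
  exact hF.comp (f := fun s => (h.bounce s, s)) x
    (h.contDiff_bounce.contDiffAt.prodMk contDiffAt_id)

theorem periodic_closingDefect : Function.Periodic h.closingDefect L := fun x => by
  rw [closingDefect, h.bounce_add_period, h.perimeterDeriv_add_period_left,
    h.perimeterDeriv_add_period_right, closingDefect]

theorem hasFDerivAt_perimeter (hy : y ∈ Ioo x (x + L)) :
    HasFDerivAt (fun p : ℝ × ℝ => perimeter c p.1 p.2)
      (perimeterDeriv c x y • ContinuousLinearMap.fst ℝ ℝ ℝ +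
        perimeterDeriv c y x • ContinuousLinearMap.snd ℝ ℝ ℝ) (x, y) :=
  _root_.hasFDerivAt_perimeter (h.differentiable x) (h.differentiable y) (h.ne_zero x)
    (h.ne_zero y) (h.ne hy)

theorem hasDerivAt_perimeter_bounce (x : ℝ) :
    HasDerivAt (fun s => perimeter c s (h.bounce s)) (h.closingDefect x * deriv h.bounce x) x := by
  have := (h.hasFDerivAt_perimeter (h.bounce_mem x)).comp_hasDerivAt
    (f := fun s : ℝ => (s, h.bounce s)) x ((hasDerivAt_id x).prodMk (h.hasDerivAt_bounce x))
  simpa [h.perimeterDeriv_bounce, Function.comp_def, closingDefect] using! this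

theorem exists_perimeter_bounce_eq_iff :
    (∃ C, ∀ x, perimeter c x (h.bounce x) = C) ↔ ∀ x, h.closingDefect x = 0 := by
  constructor
  · rintro ⟨C, hC⟩
    by_contra! hne
    obtain ⟨a, ha⟩ := hne
    obtain ⟨s, hs, hs'⟩ := ((eventually_ne_of_contDiff_omega h.contDiff_closingDefect ha 0).and
      (h.eventually_deriv_bounce_ne_zero 0)).exists
    have hzero := h.hasDerivAt_perimeter_bounce s
    simp only [hC] at hzero
    exact mul_ne_zero hs hs' (hzero.unique (hasDerivAt_const s C))
  · intro h0
    refine ⟨_, fun x => is_const_of_deriv_eq_zero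
      (fun s => (h.hasDerivAt_perimeter_bounce s).differentiableAt) (fun s => ?_) x 0⟩
    rw [(h.hasDerivAt_perimeter_bounce s).deriv, h0, zero_mul]

theorem hasDerivAt_perimeter_left (hy : y ∈ Ioo x (x + L)) :
    HasDerivAt (fun s => perimeter c s y) (perimeterDeriv c x y) x := by
  simpa [Function.comp_def] using! (h.hasFDerivAt_perimeter hy).comp_hasDerivAt
    (f := fun s : ℝ => (s, y)) x ((hasDerivAt_id x).prodMk (hasDerivAt_const x y))

theorem eventually_deriv_bounce_pos (hmax : ∀ s t, perimeter c s t ≤ perimeter c x (h.bounce x)) :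
    ∀ᶠ s in 𝓝[≠] x, 0 < deriv h.bounce s := by
  have hmem : ∀ᶠ s in 𝓝 x, h.bounce x ∈ Ioo s (s + L) :=
    (Continuous.prodMk_left (h.bounce x)).continuousAt.eventually
      (eventually_mem_Ioo_add (h.bounce_mem x))
  have hne := h.eventually_bounce_ne x (h.bounce x)
  have hcross : CrossesUp (-fun s => perimeterDeriv c s (h.bounce x)) x := by
    refine crossesUp_neg_deriv_of_isLocalMax (f := fun s => perimeter c s (h.bounce x))
      (hmem.mono fun s hs => h.hasDerivAt_perimeter_left hs) ?_ (.of_forall fun s => hmax s _)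
    filter_upwards [nhdsWithin_le_nhds hmem, hne] with s hs hs'
    rwa [Ne, h.perimeterDeriv_eq_zero_iff hs, eq_comm]
  refine eventually_deriv_pos_of_crossesUp (.of_forall h.hasDerivAt_bounce)
    (h.eventually_deriv_bounce_ne_zero x) (hcross.congr_sign ?_)
  filter_upwards [nhdsWithin_le_nhds hmem, hne] with s hs hs'
  rcases hs'.lt_or_gt with hlt | hlt
  · exact mul_pos_of_neg_of_neg (neg_neg_of_pos ((h.perimeterDeriv_pos_iff hs).2 hlt))
      (sub_neg.2 hlt)
  · exact mul_pos (neg_pos_of_neg ((h.perimeterDeriv_neg_iff hs).2 hlt)) (sub_pos.2 hlt)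

theorem crossesUp_neg_closingDefect {a : ℝ} (ha : h.closingDefect a ≠ 0)
    (hmax : ∀ s t, perimeter c s t ≤ perimeter c x (h.bounce x)) :
    CrossesUp (-h.closingDefect) x := by
  have h0 := eventually_ne_of_contDiff_omega h.contDiff_closingDefect ha x
  have hpos := h.eventually_deriv_bounce_pos hmax
  have hcross : CrossesUp (-fun s => h.closingDefect s * deriv h.bounce s) x :=
    crossesUp_neg_deriv_of_isLocalMax (.of_forall h.hasDerivAt_perimeter_bounce)
      ((h0.and hpos).mono fun s hs => mul_ne_zero hs.1 hs.2.ne') (.of_forall fun s => hmax s _)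
  refine hcross.congr_sign ((h0.and hpos).mono fun s hs => ?_)
  calc 0 < h.closingDefect s ^ 2 * deriv h.bounce s := mul_pos (sq_pos_of_ne_zero hs.1) hs.2
    _ = (-fun s => h.closingDefect s * deriv h.bounce s) s * (-h.closingDefect) s := by
      simp only [Pi.neg_apply]; ring

theorem exists_crossesUp_closingDefect (hx : CrossesUp (-h.closingDefect) x) :
    ∃ z, CrossesUp h.closingDefect z := by
  have hL := half_pos h.pos
  obtain ⟨a, ha, haI⟩ := (hx.2.and (Ioo_mem_nhdsGT (lt_add_of_pos_right x hL))).exists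
  obtain ⟨b, hb, hbI⟩ := (hx.1.and (Ioo_mem_nhdsLT (sub_lt_self x hL))).exists
  rw [Pi.neg_apply, neg_pos] at ha
  rw [Pi.neg_apply, neg_lt_zero, ← h.periodic_closingDefect] at hb
  exact exists_crossesUp h.contDiff_closingDefect.continuous
    (eventually_ne_of_contDiff_omega h.contDiff_closingDefect ha.ne)
    (by linarith [haI.2, hbI.1]) ha hb

end ClosingDefect

end IsOval

section Winding

open Complex

/-- `V` has no zeros on `[a, b]`, and a continuous determination of its argument increases by `δ`
from `a` to `b`. -/
def HasArgChange (V : ℝ → ℂ) (a b δ : ℝ) : Prop :=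
  ∃ θ : ℝ → ℝ, ContinuousOn θ (Icc a b) ∧
    (∀ t ∈ Icc a b, V t ≠ 0 ∧ V t = (‖V t‖ : ℂ) * exp ((θ t : ℂ) * I)) ∧ θ b - θ a = δ

theorem hasArgChange_of_mul_mem_slitPlane {V : ℝ → ℂ} {a b : ℝ} {u : ℂ} (hu : u ≠ 0)
    (hV : ContinuousOn V (Icc a b)) (hslit : ∀ t ∈ Icc a b, u * V t ∈ slitPlane) :
    HasArgChange V a b (arg (u * V b) - arg (u * V a)) := by
  have hcont : ContinuousOn (fun t => u * V t) (Icc a b) := continuousOn_const.mul hV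
  refine ⟨fun t => arg (u * V t) - arg u, fun t ht => ?_, fun t ht => ⟨?_, ?_⟩, by ring⟩
  · exact (ContinuousAt.comp_continuousWithinAt (f := fun t => u * V t)
      (continuousAt_arg (hslit t ht)) (hcont t ht)).sub continuousWithinAt_const
  · exact right_ne_zero_of_mul (slitPlane_ne_zero (hslit t ht))
  · have hprod := norm_mul_exp_arg_mul_I (u * V t)
    have hu' := norm_mul_exp_arg_mul_I u
    rw [norm_mul, ofReal_mul] at hprod
    refine mul_left_cancel₀ hu ?_
    have hexp : exp ((arg u : ℂ) * I) ≠ 0 := exp_ne_zero _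
    rw [ofReal_sub, sub_mul, exp_sub, mul_div_assoc', mul_div_assoc', eq_div_iff hexp]
    linear_combination (-exp ((arg u : ℂ) * I)) * hprod +
      (‖V t‖ : ℂ) * exp ((arg (u * V t) : ℂ) * I) * hu'

theorem HasArgChange.trans {V : ℝ → ℂ} {a b c δ₁ δ₂ : ℝ} (h₁ : HasArgChange V a b δ₁)
    (h₂ : HasArgChange V b c δ₂) (hab : a ≤ b) (hbc : b ≤ c) :
    HasArgChange V a c (δ₁ + δ₂) := by
  obtain ⟨θ₁, hc₁, hV₁, hδ₁⟩ := h₁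
  obtain ⟨θ₂, hc₂, hV₂, hδ₂⟩ := h₂
  obtain ⟨hb, hb₁⟩ := hV₁ b (right_mem_Icc.2 hab)
  have hexp : exp ((θ₂ b : ℂ) * I) = exp ((θ₁ b : ℂ) * I) :=
    mul_left_cancel₀ (ofReal_ne_zero.2 (norm_ne_zero_iff.2 hb))
      ((hV₂ b (left_mem_Icc.2 hbc)).2.symm.trans hb₁)
  set θ : ℝ → ℝ := fun t => if t ≤ b then θ₁ t else θ₂ t - (θ₂ b - θ₁ b)
  have hθ₁ : EqOn θ θ₁ (Icc a b) := fun t ht => if_pos ht.2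
  have hθ₂ : EqOn θ (fun t => θ₂ t - (θ₂ b - θ₁ b)) (Icc b c) := fun t ht => by
    rcases ht.1.eq_or_lt with rfl | hlt
    · simp [θ]
    · exact if_neg hlt.not_ge
  refine ⟨θ, ?_, fun t ht => ?_, ?_⟩
  · rw [← Icc_union_Icc_eq_Icc hab hbc]
    exact (hc₁.congr hθ₁).union_of_isClosed ((hc₂.sub continuousOn_const).congr hθ₂)
      isClosed_Icc isClosed_Icc
  · rw [← Icc_union_Icc_eq_Icc hab hbc] at ht
    rcases ht with ht | ht
    · rw [hθ₁ ht]
      exact hV₁ t ht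
    · refine ⟨(hV₂ t ht).1, ?_⟩
      rw [hθ₂ ht, ofReal_sub, ofReal_sub, sub_mul, sub_mul, exp_sub, exp_sub, hexp,
        div_self (exp_ne_zero _), div_one]
      exact (hV₂ t ht).2
  · rw [hθ₁ (left_mem_Icc.2 hab), hθ₂ (right_mem_Icc.2 hbc)]
    linarith

theorem arg_I_mul_sub_arg_neg_I_mul {w : ℂ} (hw : 0 < w.re) :
    arg (I * w) - arg (-I * w) = Real.pi := by
  rw [neg_mul, arg_neg_eq_arg_sub_pi_of_im_pos (by simpa using hw)]
  ring

theorem hasArgChange_two_pi {V : ℝ → ℂ} (hV : Continuous V) (hper : V (2 * Real.pi) = V 0)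
    (hright : ∀ t, 0 ≤ Real.cos t → (V t).re = 0 → (V t).im < 0)
    (hleft : ∀ t, Real.cos t ≤ 0 → (V t).re = 0 → 0 < (V t).im)
    (htop : 0 < (V (Real.pi / 2)).re) (hbot : (V (3 * Real.pi / 2)).re < 0) :
    HasArgChange V 0 (2 * Real.pi) (2 * Real.pi) := by
  have hπ := Real.pi_pos
  have hslit_right : ∀ t, 0 ≤ Real.cos t → I * V t ∈ slitPlane := fun t ht => by
    rw [mem_slitPlane_iff, I_mul_re, I_mul_im, neg_pos]
    exact or_not_of_imp (hright t ht)
  have hslit_left : ∀ t, Real.cos t ≤ 0 → -I * V t ∈ slitPlane := fun t ht => by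
    rw [mem_slitPlane_iff, neg_mul, neg_re, neg_im, I_mul_re, I_mul_im, neg_neg, neg_ne_zero]
    exact or_not_of_imp (hleft t ht)
  have h₁ : HasArgChange V 0 (Real.pi / 2) _ :=
    hasArgChange_of_mul_mem_slitPlane I_ne_zero hV.continuousOn fun t ht =>
      hslit_right t (Real.cos_nonneg_of_mem_Icc ⟨by linarith [ht.1], ht.2⟩)
  have h₂ : HasArgChange V (Real.pi / 2) (3 * Real.pi / 2) _ :=
    hasArgChange_of_mul_mem_slitPlane (neg_ne_zero.2 I_ne_zero) hV.continuousOn fun t ht =>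
      hslit_left t (Real.cos_nonpos_of_pi_div_two_le_of_le ht.1 (by linarith [ht.2]))
  have h₃ : HasArgChange V (3 * Real.pi / 2) (2 * Real.pi) _ :=
    hasArgChange_of_mul_mem_slitPlane I_ne_zero hV.continuousOn fun t ht => hslit_right t <| by
      rw [← Real.cos_sub_two_pi]
      exact Real.cos_nonneg_of_mem_Icc ⟨by linarith [ht.1], by linarith [ht.2]⟩
  have harg_top := arg_I_mul_sub_arg_neg_I_mul htop
  have harg_bot := arg_I_mul_sub_arg_neg_I_mul (w := -V (3 * Real.pi / 2)) (by simpa using hbot)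
  rw [neg_mul_neg, mul_neg, ← neg_mul] at harg_bot
  convert (h₁.trans h₂ (by linarith) (by linarith)).trans h₃ (by linarith) (by linarith) using 1
  rw [hper]
  linarith

namespace HasVectorFieldIndex

variable {V : ℂ → ℂ} {z₀ : ℂ} {n : ℤ}

theorem of_conj (h : HasVectorFieldIndex (fun z => starRingEnd ℂ (V z)) z₀ n) :
    HasVectorFieldIndex V z₀ (-n) := by
  obtain ⟨R, hR, h⟩ := h
  refine ⟨R, hR, fun r hr => ?_⟩
  obtain ⟨θ, hcont, hV, hδ⟩ := h r hr
  refine ⟨fun t => -θ t, hcont.neg, fun t ht => ?_, by push_cast; linarith⟩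
  obtain ⟨hne, heq⟩ := hV t ht
  refine ⟨by simpa using hne, ?_⟩
  simpa [← exp_conj] using congrArg (starRingEnd ℂ) heq

theorem congr {W : ℂ → ℂ} (h : HasVectorFieldIndex V z₀ n) (hVW : V =ᶠ[𝓝 z₀] W) :
    HasVectorFieldIndex W z₀ n := by
  obtain ⟨R, hR, h⟩ := h
  obtain ⟨ε, hε, hball⟩ := Metric.eventually_nhds_iff_ball.1 hVW
  refine ⟨min R ε, lt_min hR hε, fun r hr => ?_⟩
  obtain ⟨θ, hcont, hV, hδ⟩ := h r ⟨hr.1, hr.2.trans_le (min_le_left _ _)⟩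
  refine ⟨θ, hcont, fun t ht => ?_, hδ⟩
  rw [← hball (circleMap z₀ r t)]
  · exact hV t ht
  · exact Metric.closedBall_subset_ball (hr.2.trans_le (min_le_right R ε))
      (circleMap_mem_closedBall z₀ hr.1.le t)

end HasVectorFieldIndex

theorem hasVectorFieldIndex_one_of_crossesUp {V : ℂ → ℂ} {z₀ : ℂ} {δ : ℝ → ℝ}
    (hV : ∀ᶠ z in 𝓝 z₀, ContinuousAt V z)
    (htop : ∀ᶠ z in 𝓝 z₀, z.re = z₀.re → z₀.im < z.im → 0 < (V z).re)
    (hbot : ∀ᶠ z in 𝓝 z₀, z.re = z₀.re → z.im < z₀.im → (V z).re < 0)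
    (hzero : ∀ᶠ z in 𝓝 z₀, (V z).re = 0 → (V z).im = -δ z.re) (hδ : CrossesUp δ z₀.re) :
    HasVectorFieldIndex V z₀ 1 := by
  have hre : Tendsto re (𝓝 z₀) (𝓝 z₀.re) := continuous_re.continuousAt
  obtain ⟨R, hR, hball⟩ := Metric.eventually_nhds_iff_ball.1
    (((hV.and (htop.and hbot)).and hzero).and
      ((hre.eventually (eventually_nhdsWithin_iff.1 hδ.1)).and
        (hre.eventually (eventually_nhdsWithin_iff.1 hδ.2))))
  refine ⟨R, hR, fun r ⟨hr, hrR⟩ => ?_⟩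
  have hmem : ∀ t, circleMap z₀ r t ∈ Metric.ball z₀ R := fun t =>
    Metric.closedBall_subset_ball hrR (circleMap_mem_closedBall z₀ hr.le t)
  have hcre : ∀ t, (circleMap z₀ r t).re = z₀.re + r * Real.cos t := by simp [circleMap]
  have hcim : ∀ t, (circleMap z₀ r t).im = z₀.im + r * Real.sin t := by simp [circleMap]
  have h3 : 3 * Real.pi / 2 = Real.pi / 2 + Real.pi := by ring
  have hvert : ∀ t, Real.cos t = 0 → (V (circleMap z₀ r t)).re ≠ 0 := fun t ht => by
    have hsin : Real.sin t ≠ 0 := fun hs => by simpa [ht, hs] using Real.sin_sq_add_cos_sq t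
    obtain ⟨⟨⟨-, htop, hbot⟩, -⟩, -⟩ := hball _ (hmem t)
    rw [hcre, hcim, ht, mul_zero, add_zero] at htop hbot
    rcases hsin.lt_or_gt with hs | hs
    · exact (hbot rfl (by linarith [mul_neg_of_pos_of_neg hr hs])).ne
    · exact (htop rfl (by linarith [mul_pos hr hs])).ne'
  obtain ⟨θ, hθ⟩ := hasArgChange_two_pi (V := fun t => V (circleMap z₀ r t))
    (continuous_iff_continuousAt.2 fun t =>
      (hball _ (hmem t)).1.1.1.comp (continuous_circleMap z₀ r).continuousAt)
    (by simp [circleMap])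
    (fun t ht h0 => by
      obtain ⟨⟨-, hzero⟩, -, hδ⟩ := hball _ (hmem t)
      have hcos := ht.lt_of_ne' fun hcos => hvert t hcos h0
      rw [hzero h0, neg_lt_zero]
      exact hδ (by rw [hcre]; exact lt_add_of_pos_right _ (mul_pos hr hcos)))
    (fun t ht h0 => by
      obtain ⟨⟨-, hzero⟩, hδ, -⟩ := hball _ (hmem t)
      have hcos := ht.lt_of_ne fun hcos => hvert t hcos h0
      rw [hzero h0, neg_pos]
      exact hδ (by rw [hcre]; exact add_lt_of_neg_right _ (mul_neg_of_pos_of_neg hr hcos)))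
    ((hball _ (hmem _)).1.1.2.1 (by simp [hcre]) (by simp [hcim, hr]))
    ((hball _ (hmem _)).1.1.2.2 (by simp [hcre, h3]) (by simp [hcim, h3, hr]))
  exact ⟨θ, by simpa using hθ⟩

theorem hasVectorFieldIndex_neg_one_of_crossesUp {V : ℂ → ℂ} {z₀ : ℂ} {δ : ℝ → ℝ}
    (hV : ∀ᶠ z in 𝓝 z₀, ContinuousAt V z)
    (htop : ∀ᶠ z in 𝓝 z₀, z.re = z₀.re → z₀.im < z.im → 0 < (V z).re)
    (hbot : ∀ᶠ z in 𝓝 z₀, z.re = z₀.re → z.im < z₀.im → (V z).re < 0)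
    (hzero : ∀ᶠ z in 𝓝 z₀, (V z).re = 0 → (V z).im = δ z.re) (hδ : CrossesUp δ z₀.re) :
    HasVectorFieldIndex V z₀ (-1) := by
  refine .of_conj (hasVectorFieldIndex_one_of_crossesUp
    (hV.mono fun z hz => continuous_conj.continuousAt.comp hz) ?_ ?_ ?_ hδ)
  · simpa using htop
  · simpa using hbot
  · simpa using hzero

end Winding

section Circle

open NormedSpace

/-- The `L`-periodic lift to `ℝ` of a curve parametrized by `ℝ / Lℤ`. -/
abbrev curveLift {L : ℝ} (γ : AddCircle L → Plane) (t : ℝ) : Plane := γ t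

theorem exists_mem_Ico_coe_eq {L : ℝ} (hL : 0 < L) (x : ℝ) (ξ : AddCircle L) :
    ∃ y ∈ Ico x (x + L), (y : AddCircle L) = ξ := by
  have : Fact (0 < L) := ⟨hL⟩
  have hξ := mem_univ ξ
  rwa [← AddCircle.coe_image_Ico_eq L x] at hξ

theorem coe_ne_coe_of_mem_Ioo {L x y : ℝ} (hy : y ∈ Ioo x (x + L)) :
    (y : AddCircle L) ≠ x := fun heq => by
  have hxL := hy.1.trans hy.2
  have : Fact (0 < L) := ⟨by linarith⟩
  exact hy.1.ne' ((AddCircle.coe_eq_coe_iff_of_mem_Ico (a := x) ⟨hy.1.le, hy.2⟩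
    ⟨le_rfl, hxL⟩).1 heq)

theorem nhds_coe_prod_coe {L : ℝ} (x y : ℝ) :
    𝓝 ((x : AddCircle L), (y : AddCircle L)) = map (Prod.map (↑) (↑)) (𝓝 (x, y)) :=
  ((QuotientAddGroup.isOpenQuotientMap_mk.prodMap
    QuotientAddGroup.isOpenQuotientMap_mk).map_nhds_eq (x, y)).symm

theorem velocity_coe {L : ℝ} (γ : AddCircle L → Plane) (x : ℝ) :
    velocity γ x = deriv (curveLift γ) x := by
  simpa [velocity, curveLift] using deriv_comp_const_add (f := curveLift γ) x 0

theorem IsAnalyticUnitSpeedParam.isOval {Ω : Set Plane} {L : ℝ} {γ : AddCircle L → Plane}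
    (hγ : IsAnalyticUnitSpeedParam Ω γ) (o : Orientation ℝ Plane (Fin 2)) (hopen : IsOpen Ω)
    (hconv : Convex ℝ Ω) (hstrict : StrictConvex ℝ (closure Ω)) (hcenter : (0 : Plane) ∈ Ω)
    (hL : 0 < L) : IsOval o (curveLift γ) L := by
  have hc : ContDiff ℝ ω (curveLift γ) := contDiff_omega_iff_analyticOnNhd.2 hγ.analytic
  have hfr : ∀ x, curveLift γ x ∈ frontier Ω := fun x => hγ.range_eq ▸ mem_range_self _
  refine ⟨hL, hc, hγ.unit_speed, fun t => by simp [curveLift], fun x y hy => ?_⟩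
  obtain ⟨f, hf, hf'⟩ := exists_strict_supporting_functional hopen hconv hstrict (hfr x)
  have hmax : IsLocalMax (fun t => f (curveLift γ t)) x := .of_forall fun t => by
    by_cases heq : curveLift γ t = curveLift γ x
    · simp only [heq, le_refl]
    · exact (hf' _ (hfr t) heq).le
  have htangent : f (deriv (curveLift γ) x) = 0 := hmax.hasDerivAt_eq_zero
    (f.hasFDerivAt.comp_hasDerivAt x (hc.differentiable (by simp) x).hasDerivAt)
  have hchord : f (curveLift γ y - curveLift γ x) < 0 := by
    rw [map_sub, sub_neg]
    exact hf' _ (hfr y) fun heq => coe_ne_coe_of_mem_Ioo hy (hγ.injective heq)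
  have hray : 0 < f (curveLift γ x) := by simpa using hf 0 hcenter
  exact areaForm_mul_areaForm_neg o
    (norm_ne_zero_iff.1 (by rw [hγ.unit_speed]; exact one_ne_zero)) htangent
    (mul_neg_of_neg_of_pos hchord hray)

theorem inChart_Psi {L : ℝ} (γ : AddCircle L → Plane) (x y : ℝ) (z : ℂ) :
    inChart (Psi γ) (x, y) z = perimeter (curveLift γ) (x + z.re) (y + z.im) := rfl

theorem GeometricallyDistinct.of_Psi_ne {L : ℝ} {γ : AddCircle L → Plane}
    {p q : AddCircle L × AddCircle L} (h : Psi γ p ≠ Psi γ q) : GeometricallyDistinct p q := by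
  refine ⟨fun heq => h (congrArg (Psi γ) heq), ?_⟩
  rintro rfl
  exact h (perimeter_comm γ q.2 q.1)

theorem eventually_chart_mem_Ioo_add {L x y : ℝ} (hy : y ∈ Ioo x (x + L)) :
    ∀ᶠ z : ℂ in 𝓝 0, y + z.im ∈ Ioo (x + z.re) (x + z.re + L) := by
  have hchart : Tendsto (fun z : ℂ => (x + z.re, y + z.im)) (𝓝 0) (𝓝 (x, y)) :=
    Continuous.tendsto' (by fun_prop) _ _ (by simp)
  exact hchart.eventually (eventually_mem_Ioo_add hy)

/-- The vector field with components the partial derivatives of the perimeter, in the chart of the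
torus centred at `(x, y)`. -/
noncomputable def perimeterField (c : ℝ → Plane) (x y : ℝ) (z : ℂ) : ℂ :=
  ⟨perimeterDeriv c (x + z.re) (y + z.im), perimeterDeriv c (y + z.im) (x + z.re)⟩

namespace IsOval

variable {L : ℝ} {γ : AddCircle L → Plane} {o : Orientation ℝ Plane (Fin 2)} {x y : ℝ}
  (h : IsOval o (curveLift γ) L)

include h

theorem reflectsTo_coe_iff (hy : y ∈ Ioo x (x + L)) :
    ReflectsTo γ x y ↔ y = h.bounce x := by
  simp only [ReflectsTo, velocity_coe]
  rw [exists_eq_smul_reflection_iff o (h.side x y hy),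
    ← h.perimeterDeriv_eq_zero_iff hy, perimeterDeriv, ← neg_sub, normalize_neg, inner_neg_right,
    neg_eq_iff_add_eq_zero, add_comm]

theorem not_reflectsTo_self (x : ℝ) : ¬ ReflectsTo γ x x := by
  rintro ⟨t, ht, heq⟩
  rw [sub_self, eq_comm, smul_eq_zero_iff_right ht.ne', LinearIsometryEquiv.map_eq_zero_iff] at heq
  exact h.ne_zero x heq

theorem reflectsTo_iff (x : ℝ) (η : AddCircle L) : ReflectsTo γ x η ↔ η = h.bounce x := by
  refine ⟨fun hη => ?_, ?_⟩
  · obtain ⟨y, hy, rfl⟩ := exists_mem_Ico_coe_eq h.pos x η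
    rcases hy.1.eq_or_lt with rfl | hxy
    · exact absurd hη (h.not_reflectsTo_self x)
    · rw [(h.reflectsTo_coe_iff ⟨hxy, hy.2⟩).1 hη]
  · rintro rfl
    exact (h.reflectsTo_coe_iff (h.bounce_mem x)).2 rfl

theorem phi_coe (x : ℝ) : phi γ x = perimeter (curveLift γ) x (h.bounce x) := by
  have hex : ∃ η, ReflectsTo γ x η := ⟨_, (h.reflectsTo_iff x _).2 rfl⟩
  rw [phi, nextParam, dif_pos hex, (h.reflectsTo_iff x _).1 hex.choose_spec]
  rfl

theorem exists_phi_eq_iff : (∃ C, ∀ ξ, phi γ ξ = C) ↔ ∀ x, h.closingDefect x = 0 := by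
  rw [← h.exists_perimeter_bounce_eq_iff]
  simp only [← h.phi_coe]
  exact exists_congr fun C => (QuotientAddGroup.mk_surjective.forall)

theorem hasGradientAt_inChart_Psi {z : ℂ} (hz : y + z.im ∈ Ioo (x + z.re) (x + z.re + L)) :
    HasGradientAt (inChart (Psi γ) (x, y)) (perimeterField (curveLift γ) x y z) z := by
  rw [hasGradientAt_iff_hasFDerivAt]
  have hchart : HasFDerivAt (fun z : ℂ => (x + z.re, y + z.im))
      (Complex.reCLM.prod Complex.imCLM) z :=
    (Complex.reCLM.hasFDerivAt.const_add x).prodMk (Complex.imCLM.hasFDerivAt.const_add y)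
  refine ((h.hasFDerivAt_perimeter hz).comp (f := fun z : ℂ => (x + z.re, y + z.im)) z
    hchart).congr_fderiv ?_
  ext w
  simp [perimeterField, Complex.inner, mul_comm]

theorem isCriticalPt_coe_iff (hy : y ∈ Ioo x (x + L)) :
    IsCriticalPt (Psi γ) (x, y) ↔ y = h.bounce x ∧ perimeterDeriv (curveLift γ) y x = 0 := by
  have hgrad := h.hasGradientAt_inChart_Psi (x := x) (y := y) (z := 0) (by simpa using hy)
  have hfield : perimeterField (curveLift γ) x y 0 = 0 ↔
      y = h.bounce x ∧ perimeterDeriv (curveLift γ) y x = 0 := by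
    simp [perimeterField, Complex.ext_iff, h.perimeterDeriv_eq_zero_iff hy]
  rw [← hfield, IsCriticalPt]
  exact ⟨hgrad.unique, fun h0 => by rwa [h0] at hgrad⟩

theorem not_isCriticalPt_diag (x : ℝ) : ¬ IsCriticalPt (Psi γ) (x, x) := fun h0 => by
  refine not_differentiableAt_perimeter_diag (h.differentiable x) (h.ne_zero x)
    (norm_ne_zero_iff.1 (by rw [h.norm_deriv]; exact one_ne_zero)) ?_
  have hchart : DifferentiableAt ℝ
      (fun p : ℝ × ℝ => Complex.equivRealProdCLM.symm (p - (x, x))) (x, x) := by fun_prop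
  have hΨ : DifferentiableAt ℝ (inChart (Psi γ) (x, x))
      (Complex.equivRealProdCLM.symm ((x, x) - (x, x))) := by
    rw [sub_self, map_zero]
    exact h0.differentiableAt
  refine (hΨ.comp (x, x) hchart).congr_of_eventuallyEq (.of_forall fun p => ?_)
  simp [inChart_Psi]

/-- The triangle with vertices `0`, `γ x` and the point where the ray from `0` reflected at `γ x`
hits the curve again, as a point of the torus. -/
noncomputable def triangle (x : ℝ) : AddCircle L × AddCircle L := (x, h.bounce x)

theorem continuous_triangle : Continuous h.triangle :=
  (AddCircle.continuous_mk' L).prodMk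
    ((AddCircle.continuous_mk' L).comp h.contDiff_bounce.continuous)

theorem isCriticalPt_iff (p : AddCircle L × AddCircle L) :
    IsCriticalPt (Psi γ) p ↔ ∃ x, h.closingDefect x = 0 ∧ h.triangle x = p := by
  constructor
  · obtain ⟨ξ, η⟩ := p
    obtain ⟨x, -, rfl⟩ := exists_mem_Ico_coe_eq h.pos 0 ξ
    obtain ⟨y, hy, rfl⟩ := exists_mem_Ico_coe_eq h.pos x η
    intro hp
    rcases hy.1.eq_or_lt with rfl | hxy
    · exact absurd hp (h.not_isCriticalPt_diag x)
    · obtain ⟨rfl, hzero⟩ := (h.isCriticalPt_coe_iff ⟨hxy, hy.2⟩).1 hp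
      exact ⟨x, hzero, rfl⟩
  · rintro ⟨x, hx, rfl⟩
    exact (h.isCriticalPt_coe_iff (h.bounce_mem x)).2 ⟨rfl, hx⟩

theorem isIsolatedCriticalPt_triangle (h0 : h.closingDefect x = 0)
    (hne : ∀ᶠ s in 𝓝[≠] x, h.closingDefect s ≠ 0) :
    IsIsolatedCriticalPt (Psi γ) (h.triangle x) := by
  refine ⟨(h.isCriticalPt_iff _).2 ⟨x, h0, rfl⟩, ?_⟩
  rw [eventually_nhdsWithin_iff, triangle, nhds_coe_prod_coe, eventually_map]
  filter_upwards [eventually_mem_Ioo_add (h.bounce_mem x),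
    continuousAt_fst.eventually (eventually_nhdsWithin_iff.1 hne)]
  rintro ⟨s, t⟩ ht hs hst hcrit
  obtain ⟨ht : t = h.bounce s, hzero⟩ := (h.isCriticalPt_coe_iff ht).1 hcrit
  subst ht
  exact hs (fun hsx : s = x => hst (congrArg h.triangle hsx)) hzero

theorem not_isIsolatedCriticalPt (h0 : ∀ x, h.closingDefect x = 0)
    (p : AddCircle L × AddCircle L) : ¬ IsIsolatedCriticalPt (Psi γ) p := by
  rintro ⟨hp, hiso⟩
  obtain ⟨x, -, rfl⟩ := (h.isCriticalPt_iff p).1 hp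
  have hne : ∀ᶠ s in 𝓝[>] x, h.triangle s ≠ h.triangle x := by
    filter_upwards [Ioo_mem_nhdsGT (lt_add_of_pos_right x h.pos)] with s hs heq
    exact coe_ne_coe_of_mem_Ioo hs (congrArg Prod.fst heq)
  have htendsto : Tendsto h.triangle (𝓝[>] x) (𝓝[≠] (h.triangle x)) :=
    tendsto_nhdsWithin_iff.2
      ⟨h.continuous_triangle.continuousAt.tendsto.mono_left nhdsWithin_le_nhds, hne⟩
  obtain ⟨s, hs⟩ := (htendsto.eventually hiso).exists
  exact hs ((h.isCriticalPt_iff _).2 ⟨s, h0 s, rfl⟩)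

theorem continuousAt_perimeterField {z : ℂ} (hz : y + z.im ∈ Ioo (x + z.re) (x + z.re + L)) :
    ContinuousAt (perimeterField (curveLift γ) x y) z := by
  have hcont : ∀ {s t}, curveLift γ s ≠ curveLift γ t →
      ContinuousAt (fun p : ℝ × ℝ => perimeterDeriv (curveLift γ) p.1 p.2) (s, t) := fun hst =>
    (contDiffAt_perimeterDeriv h.contDiff.contDiffAt h.contDiff_deriv.contDiffAt
      h.contDiff.contDiffAt (h.ne_zero _) hst).continuousAt
  have hre := (hcont (h.ne hz)).comp (f := fun z : ℂ => (x + z.re, y + z.im)) (x := z) (by fun_prop)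
  have him := (hcont (h.ne hz).symm).comp (f := fun z : ℂ => (y + z.im, x + z.re)) (x := z)
    (by fun_prop)
  exact Complex.equivRealProdCLM.symm.continuous.continuousAt.comp (hre.prodMk him)

theorem perimeterField_re_eq_zero {z : ℂ}
    (hz : y + z.im ∈ Ioo (x + z.re) (x + z.re + L))
    (h0 : (perimeterField (curveLift γ) x y z).re = 0) :
    (perimeterField (curveLift γ) x y z).im = h.closingDefect (x + z.re) := by
  rw [closingDefect, ← (h.perimeterDeriv_eq_zero_iff hz).1 h0, perimeterField]

theorem eventually_continuousAt_perimeterField (x : ℝ) :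
    ∀ᶠ z in 𝓝 0, ContinuousAt (perimeterField (curveLift γ) x (h.bounce x)) z :=
  (eventually_chart_mem_Ioo_add (h.bounce_mem x)).mono fun _ => h.continuousAt_perimeterField

theorem eventually_perimeterField_im_eq (x : ℝ) : ∀ᶠ z in 𝓝 0,
    (perimeterField (curveLift γ) x (h.bounce x) z).re = 0 →
      (perimeterField (curveLift γ) x (h.bounce x) z).im = h.closingDefect (x + z.re) :=
  (eventually_chart_mem_Ioo_add (h.bounce_mem x)).mono fun _ => h.perimeterField_re_eq_zero

theorem eventually_perimeterField_re_pos (x : ℝ) : ∀ᶠ z in 𝓝 (0 : ℂ), z.re = (0 : ℂ).re →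
    (0 : ℂ).im < z.im → 0 < (perimeterField (curveLift γ) x (h.bounce x) z).re := by
  filter_upwards [eventually_chart_mem_Ioo_add (h.bounce_mem x)] with z hz hre him
  refine (h.perimeterDeriv_pos_iff hz).2 ?_
  rw [hre, Complex.zero_re, add_zero]
  exact lt_add_of_pos_right _ him

theorem eventually_perimeterField_re_neg (x : ℝ) : ∀ᶠ z in 𝓝 (0 : ℂ), z.re = (0 : ℂ).re →
    z.im < (0 : ℂ).im → (perimeterField (curveLift γ) x (h.bounce x) z).re < 0 := by
  filter_upwards [eventually_chart_mem_Ioo_add (h.bounce_mem x)] with z hz hre him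
  refine (h.perimeterDeriv_neg_iff hz).2 ?_
  rw [hre, Complex.zero_re, add_zero]
  exact add_lt_of_neg_right _ him

theorem hasCriticalIndex_of_perimeterField {n : ℤ}
    (hn : HasVectorFieldIndex (perimeterField (curveLift γ) x (h.bounce x)) 0 n) :
    HasCriticalIndex (Psi γ) (h.triangle x) n :=
  hn.congr ((eventually_chart_mem_Ioo_add (h.bounce_mem x)).mono fun _ hz =>
    (h.hasGradientAt_inChart_Psi hz).gradient.symm)

theorem hasCriticalIndex_one (hx : CrossesUp (-h.closingDefect) x) :
    HasCriticalIndex (Psi γ) (h.triangle x) 1 :=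
  h.hasCriticalIndex_of_perimeterField <| hasVectorFieldIndex_one_of_crossesUp
    (h.eventually_continuousAt_perimeterField x) (h.eventually_perimeterField_re_pos x)
    (h.eventually_perimeterField_re_neg x)
    (by simpa using h.eventually_perimeterField_im_eq x) hx.comp_const_add

theorem hasCriticalIndex_neg_one (hx : CrossesUp h.closingDefect x) :
    HasCriticalIndex (Psi γ) (h.triangle x) (-1) :=
  h.hasCriticalIndex_of_perimeterField <| hasVectorFieldIndex_neg_one_of_crossesUp
    (h.eventually_continuousAt_perimeterField x) (h.eventually_perimeterField_re_pos x)
    (h.eventually_perimeterField_re_neg x) (h.eventually_perimeterField_im_eq x) hx.comp_const_add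

theorem exists_forall_Psi_le : ∃ p, ∀ q, Psi γ q ≤ Psi γ p := by
  have : Fact (0 < L) := ⟨h.pos⟩
  have hγ : Continuous γ :=
    QuotientAddGroup.isOpenQuotientMap_mk.isQuotientMap.continuous_iff.2 h.contDiff.continuous
  have hΨ : Continuous (Psi γ) := by
    unfold Psi
    fun_prop
  obtain ⟨p, -, hp⟩ := isCompact_univ.exists_isMaxOn univ_nonempty hΨ.continuousOn
  exact ⟨p, fun q => hp (mem_univ q)⟩

theorem exists_forall_Psi_le_triangle : ∃ x, ∀ q, Psi γ q ≤ Psi γ (h.triangle x) := by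
  obtain ⟨⟨ξ, η⟩, hmax⟩ := h.exists_forall_Psi_le
  obtain ⟨x, -, rfl⟩ := exists_mem_Ico_coe_eq h.pos 0 ξ
  obtain ⟨y, hy, hmax⟩ : ∃ y ∈ Ioo x (x + L), ∀ q, Psi γ q ≤ Psi γ (x, y) := by
    obtain ⟨y, hy, rfl⟩ := exists_mem_Ico_coe_eq h.pos x η
    rcases hy.1.eq_or_lt with rfl | hxy
    · refine ⟨h.bounce x, h.bounce_mem x, fun q => (hmax q).trans ?_⟩
      have hle := norm_le_norm_add_norm_sub (γ (h.bounce x)) (γ x)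
      simp only [Psi, sub_self, norm_zero]
      linarith
    · exact ⟨y, ⟨hxy, hy.2⟩, hmax⟩
  have hloc : IsLocalMax (fun s => perimeter (curveLift γ) s y) x :=
    .of_forall fun s => hmax (s, y)
  have hzero := hloc.hasDerivAt_eq_zero (h.hasDerivAt_perimeter_left hy)
  obtain rfl := (h.perimeterDeriv_eq_zero_iff hy).1 hzero
  exact ⟨x, hmax⟩

end IsOval

end Circle

theorem proposition3p5 (Ω : Set Plane) (hopen : IsOpen Ω) (hbdd : Bornology.IsBounded Ω)
    (hconv : Convex ℝ Ω) (hstrict : StrictConvex ℝ (closure Ω)) (hcenter : (0 : Plane) ∈ Ω)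
    (L : ℝ) (hL : 0 < L) (γ : AddCircle L → Plane) (hγ : IsAnalyticUnitSpeedParam Ω γ) :
    Xor (∃ C : ℝ, ∀ ξ : AddCircle L, phi γ ξ = C)
      (∃ p q : AddCircle L × AddCircle L,
        IsIsolatedCriticalPt (Psi γ) p ∧ IsIsolatedCriticalPt (Psi γ) q ∧
        GeometricallyDistinct p q ∧
        (∀ x : AddCircle L × AddCircle L, Psi γ x ≤ Psi γ p) ∧
        HasCriticalIndex (Psi γ) p 1 ∧
        ∃ n : ℤ, n < 0 ∧ HasCriticalIndex (Psi γ) q n) := by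
  have h := hγ.isOval (EuclideanSpace.basisFun (Fin 2) ℝ).toBasis.orientation hopen hconv hstrict
    hcenter hL
  by_cases hdefect : ∀ x, h.closingDefect x = 0
  · exact .inl ⟨h.exists_phi_eq_iff.2 hdefect, fun ⟨p, _, hp, _⟩ =>
      h.not_isIsolatedCriticalPt hdefect p hp⟩
  refine .inr ⟨?_, fun hC => hdefect (h.exists_phi_eq_iff.1 hC)⟩
  obtain ⟨a, ha⟩ := not_forall.1 hdefect
  have hdown : ∀ x, (∀ p, Psi γ p ≤ Psi γ (h.triangle x)) → CrossesUp (-h.closingDefect) x :=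
    fun x hx => h.crossesUp_neg_closingDefect ha fun s t => hx (s, t)
  obtain ⟨x, hmax⟩ := h.exists_forall_Psi_le_triangle
  obtain ⟨z, hz⟩ := h.exists_crossesUp_closingDefect (hdown x hmax)
  have hne : Psi γ (h.triangle x) ≠ Psi γ (h.triangle z) := fun heq =>
    hz.not_neg (hdown z (heq ▸ hmax))
  have hiso := eventually_ne_of_contDiff_omega h.contDiff_closingDefect ha
  have hcont := h.contDiff_closingDefect.continuous
  have hx0 : h.closingDefect x = 0 :=
    neg_eq_zero.1 ((hdown x hmax).eq_zero hcont.neg.continuousAt)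
  exact ⟨_, _, h.isIsolatedCriticalPt_triangle hx0 (hiso x),
    h.isIsolatedCriticalPt_triangle (hz.eq_zero hcont.continuousAt) (hiso z), .of_Psi_ne hne, hmax,
    h.hasCriticalIndex_one (hdown x hmax), -1, by norm_num, h.hasCriticalIndex_neg_one hz⟩
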